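/- Let $\mathcal D$ be the set of dyadic subintervals $[k2^{-n},(k+1)2^{-n})$, $n\ge 0$, $0\le k<2^n$, of $[0,1)$, and for $J\in\mathcal D$ write $|J|$ for its length, $\mathcal D(J)=\{K\in\mathcal D: K\subseteq J\}$ and $\langle f\rangle_J=\frac1{|J|}\int_J f$. The Carleson constant of a sequence $\alpha=\{\alpha_J\}_{J\in\mathcal D}$ of nonnegative real numbers is $\sup_{J\in\mathcal D}\frac1{|J|}\sum_{K\in\mathcal D(J)}\alpha_K|K|$. For nonnegative $f\in L^1([0,1))$ put $$\mathcal A_\alpha f(x)=\sum_{J\in\mathcal D}\alpha_J\langle f\rangle_J\mathbf 1_J(x)\in[0,\infty],\qquad x\in[0,1),$$ and let $\|g\|_{L^{1,\infty}}=\sup_{\lambda>0}\lambda\,|\{x\in[0,1): |g(x)|>\lambda\}|$. For $t\ge 0$ and $\lambda>0$ let $$b(t,\lambda)=\frac{2t}{\lambda+t}\ \text{ if } t\le\lambda,\qquad b(t,\lambda)=1\ \text{ if } t>\lambda .$$ (1) For every nonnegative $f\in L^1([0,1))$, every $\alpha$ with Carleson constant at most $1$ and every $\lambda>0$, $$|\{x\in[0,1):\mathcal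 A_\alpha f(x)>\lambda\}|\le b(\|f\|_{L^1},\lambda).$$ (2) This bound is sharp: for every $t\ge0$ and $\lambda>0$, $b(t,\lambda)$ is the supremum of $|\{x\in[0,1):\mathcal A_\alpha f(x)>\lambda\}|$ over all nonnegative $f\in L^1([0,1))$ with $\|f\|_{L^1}=t$ and all $\alpha$ with Carleson constant at most $1$. (3) For every nonnegative $f\in L^1([0,1))$ and every $\alpha$ with Carleson constant at most $1$, $\|\mathcal A_\alpha f\|_{L^{1,\infty}}\le 2\|f\|_{L^1}$. (4) The constant $2$ is sharp: if $C$ is such that $\|\mathcal A_\alpha f\|_{L^{1,\infty}}\le C\|f\|_{L^1}$ for all such $f$ and $\alpha$, then $C\ge 2$. -/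

import Mathlib

open MeasureTheory Set
open scoped NNReal ENNReal

noncomputable section

namespace DyadicShift

/-- Indices of the dyadic subintervals of `[0,1)`: the pair `(n, k)` with `k < 2 ^ n` stands for
`[k / 2 ^ n, (k + 1) / 2 ^ n)`. -/
abbrev Dyadic : Type := Σ n : ℕ, Fin (2 ^ n)

/-- The dyadic interval `[k / 2 ^ n, (k + 1) / 2 ^ n)`. -/
def Dyadic.interval (J : Dyadic) : Set ℝ :=
  Ico ((J.2 : ℝ) / 2 ^ J.1) (((J.2 : ℝ) + 1) / 2 ^ J.1)

/-- The Carleson constant `sup_J |J|⁻¹ ∑_{K ∈ D(J)} α_K |K|` of a nonnegative sequence indexed by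
the dyadic subintervals of `[0,1)`. -/
def carlesonConst (α : Dyadic → ℝ≥0) : ℝ≥0∞ :=
  ⨆ J : Dyadic,
    (∑' K : {K : Dyadic // K.interval ⊆ J.interval}, (α K : ℝ≥0∞) * volume K.1.interval) /
      volume J.interval

/-- The operator `𝒜 f (x) = ∑_J α_J ⟨f⟩_J 1_J(x)`, for `f` nonnegative (almost everywhere) and
integrable on `[0,1)`. The series has nonnegative terms and is summed in `[0, ∞]`. -/
def lernerOp (α : Dyadic → ℝ≥0) (f : ℝ → ℝ) (x : ℝ) : ℝ≥0∞ :=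
  ∑' J : Dyadic,
    J.interval.indicator (fun _ => (α J : ℝ≥0∞) * ENNReal.ofReal (⨍ y in J.interval, f y)) x

/-- `f` is a nonnegative element of `L¹([0,1))`. -/
def NonnegL1 (f : ℝ → ℝ) : Prop :=
  IntegrableOn f (Ico 0 1) ∧ ∀ᵐ x ∂volume.restrict (Ico (0 : ℝ) 1), 0 ≤ f x

/-- The norm of `L¹([0,1))`. -/
def normL1 (f : ℝ → ℝ) : ℝ := ∫ x in Ico (0 : ℝ) 1, |f x|

/-- The measure of the superlevel set `{x ∈ [0,1) : g x > lam}`. -/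
def distrib (g : ℝ → ℝ≥0∞) (lam : ℝ) : ℝ≥0∞ :=
  volume {x : ℝ | x ∈ Ico (0 : ℝ) 1 ∧ ENNReal.ofReal lam < g x}

/-- The quasinorm of `L^{1,∞}([0,1))`: `sup_{lam > 0} lam |{x ∈ [0,1) : g x > lam}|`. -/
def weakL1 (g : ℝ → ℝ≥0∞) : ℝ≥0∞ :=
  ⨆ (lam : ℝ) (_ : 0 < lam), ENNReal.ofReal lam * distrib g lam

/-- The bound, as a function of `t = ‖f‖₁` and the level `lam`. -/
def levelBound (t lam : ℝ) : ℝ := if t ≤ lam then 2 * t / (lam + t) else 1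

end DyadicShift

end

noncomputable section

namespace DyadicShift

/-! ### The dyadic tree -/

/-! The upper bound is a Bellman function argument. Let `x` be the average of `f` over `J` divided
by the level, and `A` the Carleson mass below `J` divided by `J.len`. The fraction of `J` where the
part of the operator living in `J` exceeds the level is at most `bellman x A`. Passing to the halves
averages the data and removes the term `a = α J`: the mass drops to `A - a` and, after renormalizing
the lowered level, `x` becomes `x / (1 - a * x)`. Induction over generations therefore needs only
midpoint concavity (`bellman_midpoint`) and the jump inequality (`bellman_jump`). Monotone limits
remove the restriction to finitely many generations, and `A = 1` gives `levelBound`.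

For sharpness, start with a constant just above its level and unit mass at the top. Repeatedly put a
copy on one half and a slightly diluted copy on the other, and spend the mass thus freed on the
parent (`Achievable.step`). With ratio `r` near `1`, a final fraction `v` and initial height `y`
lead to average `v * y` and level close to `(2 - v) * y`, hence `v` close to `2 * t / (lam + t)`.
Small `t` then gives the constant `2`. -/

/-- The left half of a dyadic interval. -/
def Dyadic.left (J : Dyadic) : Dyadic :=
  ⟨J.1 + 1, ⟨2 * J.2, by have := J.2.2; rw [pow_succ]; omega⟩⟩

/-- The right half of a dyadic interval. -/
def Dyadic.right (J : Dyadic) : Dyadic :=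
  ⟨J.1 + 1, ⟨2 * J.2 + 1, by have := J.2.2; rw [pow_succ]; omega⟩⟩

/-- The interval `[0,1)`. -/
def Dyadic.root : Dyadic := ⟨0, ⟨0, by norm_num⟩⟩

/-- The length of a dyadic interval. -/
def Dyadic.len (J : Dyadic) : ℝ := (2 ^ J.1)⁻¹

lemma Dyadic.len_pos (J : Dyadic) : 0 < J.len := by unfold Dyadic.len; positivity

lemma Dyadic.len_left (J : Dyadic) : J.left.len = J.len / 2 := by
  simp only [Dyadic.len, Dyadic.left, pow_succ]; field_simp

lemma Dyadic.len_right (J : Dyadic) : J.right.len = J.len / 2 := by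
  simp only [Dyadic.len, Dyadic.right, pow_succ]; field_simp

lemma Dyadic.volume_interval (J : Dyadic) : volume J.interval = ENNReal.ofReal J.len := by
  rw [Dyadic.interval, Real.volume_Ico, Dyadic.len]
  congr 1
  field_simp
  ring

lemma Dyadic.volume_real_interval (J : Dyadic) : volume.real J.interval = J.len := by
  rw [Measure.real, J.volume_interval, ENNReal.toReal_ofReal J.len_pos.le]

lemma Dyadic.measurableSet_interval (J : Dyadic) : MeasurableSet J.interval := measurableSet_Ico

lemma Dyadic.interval_eq (J : Dyadic) :
    J.interval = Ico (J.2 * J.len) ((J.2 + 1) * J.len) := by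
  simp only [Dyadic.interval, Dyadic.len, div_eq_mul_inv]

lemma Dyadic.interval_left (J : Dyadic) :
    J.left.interval = Ico (J.2 * J.len) ((J.2 + 1 / 2) * J.len) := by
  rw [Dyadic.interval_eq, Dyadic.len_left]
  simp only [Dyadic.left, Nat.cast_mul, Nat.cast_ofNat]
  congr 1 <;> ring

lemma Dyadic.interval_right (J : Dyadic) :
    J.right.interval = Ico ((J.2 + 1 / 2) * J.len) ((J.2 + 1) * J.len) := by
  rw [Dyadic.interval_eq, Dyadic.len_right]
  simp only [Dyadic.right, Nat.cast_mul, Nat.cast_ofNat, Nat.cast_add, Nat.cast_one]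
  congr 1 <;> ring

lemma Dyadic.interval_union (J : Dyadic) :
    J.left.interval ∪ J.right.interval = J.interval := by
  rw [J.interval_left, J.interval_right, J.interval_eq]
  have := J.len_pos
  exact Ico_union_Ico_eq_Ico (by nlinarith) (by nlinarith)

lemma Dyadic.disjoint_interval (J : Dyadic) : Disjoint J.left.interval J.right.interval := by
  rw [J.interval_left, J.interval_right]
  exact Set.disjoint_left.2 fun x hx hx' => (hx.2.trans_le hx'.1).false

lemma Dyadic.left_subset (J : Dyadic) : J.left.interval ⊆ J.interval :=
  J.interval_union ▸ subset_union_left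

lemma Dyadic.right_subset (J : Dyadic) : J.right.interval ⊆ J.interval :=
  J.interval_union ▸ subset_union_right

lemma Dyadic.nonempty_interval (J : Dyadic) : J.interval.Nonempty := by
  rw [J.interval_eq]
  have := J.len_pos
  exact nonempty_Ico.2 (by nlinarith)

lemma Dyadic.root_interval : Dyadic.root.interval = Ico 0 1 := by
  simp [Dyadic.interval, Dyadic.root]

lemma Dyadic.root_len : Dyadic.root.len = 1 := by
  simp [Dyadic.len, Dyadic.root]

lemma Dyadic.subset_root (J : Dyadic) : J.interval ⊆ Dyadic.root.interval := by
  rw [Dyadic.root_interval, J.interval_eq]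
  have h : ((J.2 : ℕ) : ℝ) + 1 ≤ 2 ^ J.1 := by exact_mod_cast J.2.2
  refine Ico_subset_Ico (by have := J.len_pos; positivity) ?_
  unfold Dyadic.len
  rw [← div_eq_mul_inv, div_le_one (by positivity)]
  exact h

lemma Dyadic.len_le_of_subset {K J : Dyadic} (h : K.interval ⊆ J.interval) : K.len ≤ J.len := by
  have := measure_mono (μ := volume) h
  rwa [K.volume_interval, J.volume_interval, ENNReal.ofReal_le_ofReal_iff J.len_pos.le] at this

lemma Dyadic.level_le_of_subset {K J : Dyadic} (h : K.interval ⊆ J.interval) : J.1 ≤ K.1 := by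
  have := len_le_of_subset h
  unfold Dyadic.len at this
  rw [inv_le_inv₀ (by positivity) (by positivity)] at this
  exact (pow_le_pow_iff_right₀ (by norm_num)).1 this

lemma Dyadic.not_subset_left (J : Dyadic) : ¬ J.interval ⊆ J.left.interval := fun h => by
  have := level_le_of_subset h
  simp [Dyadic.left] at this

lemma Dyadic.not_subset_right (J : Dyadic) : ¬ J.interval ⊆ J.right.interval := fun h => by
  have := level_le_of_subset h
  simp [Dyadic.right] at this

lemma Dyadic.not_subset_right_of_left {J K : Dyadic} (h : K.interval ⊆ J.left.interval) :
    ¬ K.interval ⊆ J.right.interval := fun hr => by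
  obtain ⟨x, hx⟩ := K.nonempty_interval
  exact Set.disjoint_left.1 J.disjoint_interval (h hx) (hr hx)

/-- A dyadic subinterval is the whole interval or lies in one of the halves. -/
lemma Dyadic.subset_cases {K J : Dyadic} (h : K.interval ⊆ J.interval) :
    K = J ∨ K.interval ⊆ J.left.interval ∨ K.interval ⊆ J.right.interval := by
  have hl := level_le_of_subset h
  obtain ⟨d, hd⟩ := Nat.exists_eq_add_of_le hl
  have hKl := K.len_pos
  have hlen : J.len = 2 ^ d * K.len := by
    unfold Dyadic.len
    rw [hd, pow_add]
    field_simp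
  have hsub := h
  rw [K.interval_eq, J.interval_eq, Ico_subset_Ico_iff (by nlinarith), hlen] at hsub
  obtain ⟨h1, h2⟩ := hsub
  rw [← mul_assoc, mul_le_mul_iff_left₀ hKl] at h1 h2
  have h1' : (J.2 : ℕ) * 2 ^ d ≤ K.2 := by exact_mod_cast h1
  have h2' : (K.2 : ℕ) + 1 ≤ ((J.2 : ℕ) + 1) * 2 ^ d := by exact_mod_cast h2
  rcases d with _ | d
  · left
    have hval : (K.2 : ℕ) = J.2 := by simp at h1' h2'; omega
    obtain ⟨n, j⟩ := J
    obtain ⟨n', k⟩ := K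
    simp only [Nat.add_zero] at hd
    subst hd
    congr 1
    exact Fin.ext hval
  · right
    rw [J.interval_left, J.interval_right, K.interval_eq, hlen]
    rw [pow_succ] at *
    -- In units of `K.len` the midpoint of `J` is the integer `(2 * J.2 + 1) * 2 ^ d`, so `K` cannot
    -- straddle it.
    rcases Nat.lt_or_ge (K.2 : ℕ) ((2 * J.2 + 1) * 2 ^ d) with hlt | hge
    · left
      have hlt' : ((K.2 : ℕ) : ℝ) + 1 ≤ (2 * (J.2 : ℕ) + 1) * 2 ^ d := by exact_mod_cast hlt
      refine Ico_subset_Ico ?_ ?_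
      · rw [← mul_assoc]; exact mul_le_mul_of_nonneg_right h1 hKl.le
      · rw [← mul_assoc]; exact mul_le_mul_of_nonneg_right (by linarith) hKl.le
    · right
      have hge' : (2 * ((J.2 : ℕ) : ℝ) + 1) * 2 ^ d ≤ (K.2 : ℕ) := by exact_mod_cast hge
      refine Ico_subset_Ico ?_ ?_
      · rw [← mul_assoc]; exact mul_le_mul_of_nonneg_right (by linarith) hKl.le
      · rw [← mul_assoc]; exact mul_le_mul_of_nonneg_right h2 hKl.le

/-! ### Sums over subtrees -/

/-- The sum of `g` over the dyadic subintervals of `J`. -/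
def subtreeSum (g : Dyadic → ℝ≥0∞) (J : Dyadic) : ℝ≥0∞ :=
  ∑' K : {K : Dyadic // K.interval ⊆ J.interval}, g K

lemma subtreeSum_congr {g g' : Dyadic → ℝ≥0∞} {J : Dyadic}
    (h : ∀ K : Dyadic, K.interval ⊆ J.interval → g K = g' K) :
    subtreeSum g J = subtreeSum g' J :=
  tsum_congr fun K => h K K.2

lemma subtreeSum_mono {g g' : Dyadic → ℝ≥0∞} (h : ∀ K, g K ≤ g' K) (J : Dyadic) :
    subtreeSum g J ≤ subtreeSum g' J :=
  ENNReal.tsum_le_tsum fun K => h K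

lemma subtreeSum_eq_zero {g : Dyadic → ℝ≥0∞} {J : Dyadic}
    (h : ∀ K : Dyadic, K.interval ⊆ J.interval → g K = 0) : subtreeSum g J = 0 :=
  ENNReal.tsum_eq_zero.2 fun K => h K K.2

/-- Carleson masses and the operator are both subtree sums, so this one recursion drives the
induction for both. -/
lemma subtreeSum_split (g : Dyadic → ℝ≥0∞) (J : Dyadic) :
    subtreeSum g J = g J + (subtreeSum g J.left + subtreeSum g J.right) := by
  classical
  have key (I : Dyadic) : subtreeSum g I =
      ∑' K : Dyadic, {K : Dyadic | K.interval ⊆ I.interval}.indicator g K :=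
    tsum_subtype {K : Dyadic | K.interval ⊆ I.interval} g
  rw [key, key, key, ← ENNReal.tsum_add, ← tsum_ite_eq J g, ← ENNReal.tsum_add]
  refine tsum_congr fun K => ?_
  simp only [indicator_apply, mem_ofPred_eq]
  by_cases h : K.interval ⊆ J.interval
  · rcases Dyadic.subset_cases h with rfl | h' | h'
    · simp [K.not_subset_left, K.not_subset_right]
    · have hne : K ≠ J := by rintro rfl; exact K.not_subset_left h'
      simp [h, h', hne, Dyadic.not_subset_right_of_left h']
    · have hne : K ≠ J := by rintro rfl; exact K.not_subset_right h'
      have hl : ¬ K.interval ⊆ J.left.interval :=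
        fun hl => Dyadic.not_subset_right_of_left hl h'
      simp [h, h', hne, hl]
  · have hne : K ≠ J := by rintro rfl; exact h le_rfl
    have hl : ¬ K.interval ⊆ J.left.interval := fun hl => h (hl.trans J.left_subset)
    have hr : ¬ K.interval ⊆ J.right.interval := fun hr => h (hr.trans J.right_subset)
    simp [h, hne, hl, hr]

lemma subtreeSum_root (g : Dyadic → ℝ≥0∞) : subtreeSum g Dyadic.root = ∑' K, g K := by
  have h := tsum_subtype {K : Dyadic | K.interval ⊆ Dyadic.root.interval} g
  have h2 : {K : Dyadic | K.interval ⊆ Dyadic.root.interval} = univ :=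
    eq_univ_of_forall fun K => K.subset_root
  refine h.trans ?_
  rw [h2, indicator_univ]

/-! ### Carleson masses and the operator localized to a subtree -/

/-- The Carleson mass of `α` below `J`. -/
def carlesonMass (α : Dyadic → ℝ≥0) (J : Dyadic) : ℝ≥0∞ :=
  subtreeSum (fun K => (α K : ℝ≥0∞) * volume K.interval) J

lemma carlesonConst_le_one_iff (α : Dyadic → ℝ≥0) :
    carlesonConst α ≤ 1 ↔ ∀ J : Dyadic, carlesonMass α J ≤ ENNReal.ofReal J.len := by
  unfold carlesonConst
  rw [iSup_le_iff]
  refine forall_congr' fun J => ?_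
  have hpos : ENNReal.ofReal J.len ≠ 0 := by simpa using J.len_pos
  rw [ENNReal.div_le_iff_le_mul (Or.inl (by rwa [J.volume_interval]))
    (Or.inl (by simp [J.volume_interval])), one_mul, J.volume_interval]
  rfl

/-- The summand of the operator that belongs to `K`. -/
def lernerTerm (α : Dyadic → ℝ≥0) (f : ℝ → ℝ) (x : ℝ) (K : Dyadic) : ℝ≥0∞ :=
  K.interval.indicator (fun _ => (α K : ℝ≥0∞) * ENNReal.ofReal (⨍ y in K.interval, f y)) x

/-- The part of the operator that belongs to the dyadic subintervals of `J`. -/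
def localOp (α : Dyadic → ℝ≥0) (f : ℝ → ℝ) (J : Dyadic) (x : ℝ) : ℝ≥0∞ :=
  subtreeSum (lernerTerm α f x) J

lemma localOp_root (α : Dyadic → ℝ≥0) (f : ℝ → ℝ) :
    localOp α f Dyadic.root = lernerOp α f := by
  funext x
  exact subtreeSum_root _

lemma localOp_eq_zero (α : Dyadic → ℝ≥0) (f : ℝ → ℝ) {J : Dyadic} {x : ℝ}
    (hx : x ∉ J.interval) : localOp α f J x = 0 :=
  subtreeSum_eq_zero fun _ hK => indicator_of_notMem (fun h => hx (hK h)) _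

lemma localOp_of_mem_left (α : Dyadic → ℝ≥0) (f : ℝ → ℝ) {J : Dyadic} {x : ℝ}
    (hx : x ∈ J.left.interval) :
    localOp α f J x =
      (α J : ℝ≥0∞) * ENNReal.ofReal (⨍ y in J.interval, f y) + localOp α f J.left x := by
  have h0 := localOp_eq_zero α f (J := J.right) (Set.disjoint_left.1 J.disjoint_interval hx)
  unfold localOp at *
  rw [subtreeSum_split, h0, add_zero, lernerTerm, indicator_of_mem (J.left_subset hx)]

lemma localOp_of_mem_right (α : Dyadic → ℝ≥0) (f : ℝ → ℝ) {J : Dyadic} {x : ℝ}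
    (hx : x ∈ J.right.interval) :
    localOp α f J x =
      (α J : ℝ≥0∞) * ENNReal.ofReal (⨍ y in J.interval, f y) + localOp α f J.right x := by
  have h0 := localOp_eq_zero α f (J := J.left) (Set.disjoint_right.1 J.disjoint_interval hx)
  unfold localOp at *
  rw [subtreeSum_split, h0, zero_add, lernerTerm, indicator_of_mem (J.right_subset hx)]

lemma average_eq (f : ℝ → ℝ) (J : Dyadic) :
    ⨍ y in J.interval, f y = (∫ y in J.interval, f y) / J.len := by
  rw [setAverage_eq, J.volume_real_interval, smul_eq_mul, div_eq_inv_mul]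

lemma integral_split {f : ℝ → ℝ} {J : Dyadic} (hf : IntegrableOn f J.interval) :
    ∫ y in J.interval, f y =
      (∫ y in J.left.interval, f y) + ∫ y in J.right.interval, f y := by
  conv_lhs => rw [← J.interval_union]
  exact setIntegral_union J.disjoint_interval J.right.measurableSet_interval
    (hf.mono_set J.left_subset) (hf.mono_set J.right_subset)

lemma average_split {f : ℝ → ℝ} {J : Dyadic} (hf : IntegrableOn f J.interval) :
    ⨍ y in J.interval, f y =
      ((⨍ y in J.left.interval, f y) + ⨍ y in J.right.interval, f y) / 2 := by
  have := J.len_pos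
  rw [average_eq, average_eq, average_eq, integral_split hf, J.len_left, J.len_right]
  field_simp

/-! ### The Bellman function -/

/-- The positively homogeneous concave function whose truncation at height one is the Bellman
function. -/
def bellmanHom (x A : ℝ) : ℝ := if x ≤ A then 2 * x * A / (x + A) else √(x * A)

/-- The Bellman function at level one: `x` is the average of the function and `A` the normalized
Carleson mass. -/
def bellman (x A : ℝ) : ℝ := min (bellmanHom x A) 1

lemma harmonic_le_sqrt {x A : ℝ} (hx : 0 ≤ x) (hA : 0 ≤ A) : 2 * x * A / (x + A) ≤ √(x * A) := by
  rcases (add_nonneg hx hA).eq_or_lt with h | h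
  · rw [← h, div_zero]; positivity
  · refine Real.le_sqrt_of_sq_le ?_
    rw [div_pow, div_le_iff₀ (by positivity)]
    nlinarith [mul_nonneg (mul_nonneg hx hA) (sq_nonneg (x - A))]

lemma bellmanHom_le_sqrt {x A : ℝ} (hx : 0 ≤ x) (hA : 0 ≤ A) : bellmanHom x A ≤ √(x * A) := by
  unfold bellmanHom
  split_ifs
  · exact harmonic_le_sqrt hx hA
  · exact le_rfl

lemma bellmanHom_nonneg {x A : ℝ} (hx : 0 ≤ x) (hA : 0 ≤ A) : 0 ≤ bellmanHom x A := by
  unfold bellmanHom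
  split_ifs <;> positivity

lemma bellmanHom_self {x : ℝ} (hx : 0 ≤ x) : √(x * x) = bellmanHom x x := by
  rw [bellmanHom, if_pos le_rfl, Real.sqrt_mul_self hx]
  rcases hx.eq_or_lt with rfl | h
  · simp
  · field_simp; norm_num

/-- The Bellman function has a supporting linear functional at every point. -/
lemma exists_support {x A : ℝ} (hx : 0 ≤ x) (hA : 0 < A) :
    ∃ p q : ℝ, 0 ≤ p ∧ 0 ≤ q ∧ p * x + q * A = bellmanHom x A ∧
      ∀ y B : ℝ, 0 ≤ y → 0 ≤ B → bellmanHom y B ≤ p * y + q * B := by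
  rcases le_or_gt x A with h | h
  · obtain ⟨θ, hθ⟩ : ∃ θ, θ = A / (x + A) := ⟨_, rfl⟩
    have hpos : 0 < x + A := by linarith
    have hθ1 : 1 / 2 ≤ θ := by rw [hθ, le_div_iff₀ hpos]; linarith
    -- The gradient of the harmonic mean at `(x, A)`.
    refine ⟨2 * θ ^ 2, 2 * (1 - θ) ^ 2, by positivity, by positivity, ?_, ?_⟩
    · rw [bellmanHom, if_pos h, hθ]
      field_simp
      ring
    · intro y B hy hB
      unfold bellmanHom
      split_ifs with hyB
      · rcases (add_nonneg hy hB).eq_or_lt with h0 | h0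
        · rw [← h0, div_zero]; positivity
        · rw [div_le_iff₀ h0]
          nlinarith [sq_nonneg (θ * y - (1 - θ) * B)]
      -- Across the diagonal, compare with the tangent `(y + B) / 2` there; `1 / 2 ≤ θ` makes the
      -- chosen functional larger when `B < y`.
      · have h1 : √(y * B) ≤ (y + B) / 2 := by
          refine Real.sqrt_le_iff.2 ⟨by positivity, ?_⟩
          nlinarith [sq_nonneg (y - B)]
        have h2 : 0 ≤ (θ - 1 / 2) * (θ + 1 / 2) * (y - B) :=
          mul_nonneg (mul_nonneg (by linarith) (by linarith)) (by linarith)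
        nlinarith [mul_nonneg (sq_nonneg (θ - 1 / 2)) hB]
  · obtain ⟨s, hs⟩ : ∃ s, s = √A := ⟨_, rfl⟩
    obtain ⟨u, hu⟩ : ∃ u, u = √x := ⟨_, rfl⟩
    have hs0 : 0 < s := hs ▸ Real.sqrt_pos.2 hA
    have hu0 : 0 < u := hu ▸ Real.sqrt_pos.2 (hA.trans h)
    have hs2 : A = s ^ 2 := by rw [hs, Real.sq_sqrt hA.le]
    have hu2 : x = u ^ 2 := by rw [hu, Real.sq_sqrt hx]
    -- The gradient of the geometric mean; the bound on both regions is then a weighted AM-GM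
    -- inequality.
    refine ⟨s / u / 2, u / s / 2, by positivity, by positivity, ?_, ?_⟩
    · rw [bellmanHom, if_neg h.not_ge, Real.sqrt_mul hx, ← hs, ← hu, hs2, hu2]
      field_simp
      norm_num
    · intro y B hy hB
      refine (bellmanHom_le_sqrt hy hB).trans ?_
      refine Real.sqrt_le_iff.2 ⟨by positivity, ?_⟩
      have : y * B = (s / u * y) * (u / s * B) := by field_simp
      rw [this]
      nlinarith [sq_nonneg (s / u * y - u / s * B)]

lemma bellmanHom_zero_right {x : ℝ} (hx : 0 ≤ x) : bellmanHom x 0 = 0 :=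
  le_antisymm (by simpa using bellmanHom_le_sqrt hx le_rfl) (bellmanHom_nonneg hx le_rfl)

/-- Evaluate at both endpoints the functional supporting at the midpoint. It is available only for
positive mass, so zero mass is treated apart. -/
lemma bellmanHom_midpoint {x₀ x₁ A₀ A₁ : ℝ} (hx₀ : 0 ≤ x₀) (hx₁ : 0 ≤ x₁) (hA₀ : 0 ≤ A₀)
    (hA₁ : 0 ≤ A₁) :
    (bellmanHom x₀ A₀ + bellmanHom x₁ A₁) / 2 ≤ bellmanHom ((x₀ + x₁) / 2) ((A₀ + A₁) / 2) := by
  rcases (add_nonneg hA₀ hA₁).eq_or_lt with h | h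
  · have h0 : A₀ = 0 := by linarith
    have h1 : A₁ = 0 := by linarith
    subst h0 h1
    rw [bellmanHom_zero_right hx₀, bellmanHom_zero_right hx₁]
    simpa using bellmanHom_nonneg (x := (x₀ + x₁) / 2) (by positivity) le_rfl
  · obtain ⟨p, q, -, -, heq, hle⟩ :=
      exists_support (x := (x₀ + x₁) / 2) (A := (A₀ + A₁) / 2) (by positivity) (by positivity)
    rw [← heq]
    linarith [hle x₀ A₀ hx₀ hA₀, hle x₁ A₁ hx₁ hA₁]

lemma bellman_midpoint {x₀ x₁ A₀ A₁ : ℝ} (hx₀ : 0 ≤ x₀) (hx₁ : 0 ≤ x₁) (hA₀ : 0 ≤ A₀)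
    (hA₁ : 0 ≤ A₁) :
    (bellman x₀ A₀ + bellman x₁ A₁) / 2 ≤ bellman ((x₀ + x₁) / 2) ((A₀ + A₁) / 2) := by
  have := bellmanHom_midpoint hx₀ hx₁ hA₀ hA₁
  unfold bellman
  refine le_min ?_ ?_
  · linarith [min_le_left (bellmanHom x₀ A₀) 1, min_le_left (bellmanHom x₁ A₁) 1]
  · linarith [min_le_right (bellmanHom x₀ A₀) 1, min_le_right (bellmanHom x₁ A₁) 1]

lemma bellman_mono_right {x A B : ℝ} (hx : 0 ≤ x) (hA : 0 ≤ A) (hAB : A ≤ B) :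
    bellman x A ≤ bellman x B := by
  refine min_le_min_right _ ?_
  rcases hA.eq_or_lt with rfl | h
  · rw [bellmanHom_zero_right hx]
    exact bellmanHom_nonneg hx hAB
  · obtain ⟨p, q, -, hq, heq, hle⟩ := exists_support hx (h.trans_le hAB)
    rw [← heq]
    refine (hle x A hx hA).trans ?_
    gcongr

lemma bellman_nonneg {x A : ℝ} (hx : 0 ≤ x) (hA : 0 ≤ A) : 0 ≤ bellman x A :=
  le_min (bellmanHom_nonneg hx hA) zero_le_one

lemma bellman_eq_one {x A : ℝ} (hx : 0 ≤ x) (hA1 : A ≤ 1) (h : 1 ≤ x * A) :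
    bellman x A = 1 := by
  have hx1 : 1 ≤ x := by nlinarith
  refine min_eq_right ?_
  unfold bellmanHom
  split_ifs with hxA
  · rw [le_div_iff₀ (by linarith)]
    nlinarith
  · exact Real.one_le_sqrt.2 h

/-- In reciprocals, `1/x - 1/y = a`, while `1/A - 1/(A + a) = a / (A * (A + a))` is at least `a`
because masses are at most `1`. Hence the harmonic mean does not decrease. -/
lemma jump_of_le {x y A a : ℝ} (hx : 0 < x) (hy : 0 < y) (ha : 0 ≤ a) (hAa : A + a ≤ 1)
    (hxy : y * (1 - a * x) = x) (hyA : y ≤ A) : bellmanHom y A ≤ bellmanHom x (A + a) := by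
  have hxy' : x ≤ y := by nlinarith [mul_nonneg (mul_nonneg ha hx.le) hy.le]
  have hA : 0 < A := hy.trans_le hyA
  unfold bellmanHom
  rw [if_pos hyA, if_pos (by linarith), div_le_div_iff₀ (by linarith) (by linarith)]
  have hAA : A * (A + a) ≤ 1 := by nlinarith
  have h1 : 0 ≤ a * x * y * (1 - A * (A + a)) :=
    mul_nonneg (mul_nonneg (mul_nonneg ha hx.le) hy.le) (by linarith)
  have hxe : x = y - a * x * y := by linarith
  have key : 2 * x * (A + a) * (y + A) - 2 * y * A * (x + (A + a)) =
      2 * (a * x * y - A * (A + a) * (y - x)) := by ring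
  have : y - x = a * x * y := by linarith
  rw [this] at key
  nlinarith

/-- Rests on `x * (A + a) - y * A = a * y * (1 - x * (A + a))`. The right side is negative only
where the truncation already gives the value `1`. -/
lemma jump_of_ge {x y A a : ℝ} (hx : 0 < x) (hy : 0 < y) (hA : 0 ≤ A) (ha : 0 ≤ a)
    (hAa : A + a ≤ 1)
    (hxy : y * (1 - a * x) = x) (hxA : A + a ≤ x) : bellman y A ≤ bellman x (A + a) := by
  rcases le_or_gt 1 (x * (A + a)) with h | h
  · rw [bellman_eq_one hx.le hAa h]
    exact min_le_right _ _
  · refine min_le_min_right _ ((bellmanHom_le_sqrt hy.le hA).trans ?_)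
    have hsq : bellmanHom x (A + a) = √(x * (A + a)) := by
      rcases hxA.eq_or_lt with he | hl
      · rw [he, bellmanHom_self hx.le]
      · rw [bellmanHom, if_neg hl.not_ge]
    rw [hsq]
    refine Real.sqrt_le_sqrt ?_
    have h1 : 0 < 1 - a * x := by nlinarith [mul_nonneg hA hx.le]
    have h2 : x * (A + a) - y * A = a * y * (1 - x * (A + a)) := by
      have hxe : x = y - a * x * y := by linarith
      linear_combination (A + a) * hxe
    nlinarith [mul_nonneg (mul_nonneg ha hy.le) (by linarith : 0 ≤ 1 - x * (A + a))]

/-- Moving the mass `a` from the sequence into the level does not increase the Bellman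
function. -/
lemma bellman_jump {x A a : ℝ} (hx : 0 ≤ x) (hA : 0 ≤ A) (ha : 0 ≤ a) (hAa : A + a ≤ 1)
    (hax : a * x < 1) : bellman (x / (1 - a * x)) A ≤ bellman x (A + a) := by
  rcases hx.eq_or_lt with rfl | hx
  · simpa using bellman_mono_right le_rfl hA (by linarith)
  obtain ⟨y, hy⟩ : ∃ y, y = x / (1 - a * x) := ⟨_, rfl⟩
  have hd : 0 < 1 - a * x := by linarith
  have hy0 : 0 < y := hy ▸ div_pos hx hd
  have hxy : y * (1 - a * x) = x := by rw [hy, div_mul_cancel₀ _ hd.ne']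
  rw [← hy]
  rcases le_or_gt y A with hyA | hyA
  · exact min_le_min_right _ (jump_of_le hx hy0 ha hAa hxy hyA)
  rcases le_or_gt (A + a) x with hxA | hxA
  · exact jump_of_ge hx hy0 hA ha hAa hxy hxA
  -- the path from `(x, A + a)` to `(y, A)` crosses the diagonal
  obtain ⟨c, ⟨hc0, hca⟩, hc⟩ : (0 : ℝ) ∈ (fun c : ℝ => (1 - c * x) * (A + a - c) - x) '' Icc 0 a := by
    refine intermediate_value_Icc' ha (by fun_prop) ⟨?_, ?_⟩
    · show (1 - a * x) * (A + a - a) - x ≤ 0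
      nlinarith
    · show 0 ≤ (1 - 0 * x) * (A + a - 0) - x
      linarith
  simp only at hc
  obtain ⟨z, hz⟩ : ∃ z, z = A + a - c := ⟨_, rfl⟩
  have hd' : 0 < 1 - c * x := by nlinarith
  have hzx : z * (1 - c * x) = x := by rw [hz]; linarith
  have hz0 : 0 < z := by
    by_contra hcon
    nlinarith
  have h1 : bellmanHom z z ≤ bellmanHom x (z + c) :=
    jump_of_le hx hz0 hc0 (by linarith) hzx le_rfl
  -- Jumps compose: removing `c`, then `a - c`, has the same effect on the average as removing `a`.
  have hyz : y * (1 - (a - c) * z) = z := by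
    have h3 : (1 - c * x) * (1 - (a - c) * z) = 1 - a * x := by
      linear_combination (-(a - c)) * hzx
    have h4 : (1 - c * x) * (y * (1 - (a - c) * z)) = (1 - c * x) * z := by
      linear_combination y * h3 + hxy - hzx
    exact mul_left_cancel₀ hd'.ne' h4
  have hzA : A + (a - c) = z := by linarith
  have h2 := jump_of_ge hz0 hy0 hA (by linarith : 0 ≤ a - c) (by linarith) hyz hzA.le
  rw [hzA] at h2
  have hzc : z + c = A + a := by linarith
  rw [hzc] at h1
  exact h2.trans (min_le_min_right _ h1)

lemma bellman_one {t lam : ℝ} (ht : 0 ≤ t) (hlam : 0 < lam) :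
    bellman (t / lam) 1 = levelBound t lam := by
  unfold levelBound
  split_ifs with h
  · have h' : t / lam ≤ 1 := (div_le_one hlam).2 h
    have hp : 0 < lam + t := by linarith
    have he : bellmanHom (t / lam) 1 = 2 * t / (lam + t) := by
      rw [bellmanHom, if_pos h']
      field_simp
      ring
    rw [bellman, he, min_eq_left]
    rw [div_le_one hp]
    linarith
  · have h' : 1 ≤ t / lam := (one_le_div hlam).2 (by linarith)
    exact bellman_eq_one (by positivity) le_rfl (by linarith)

/-! ### The upper bound -/

/-- The Carleson mass of `α` below `J`, divided by the length of `J`. -/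
def massDensity (α : Dyadic → ℝ≥0) (J : Dyadic) : ℝ := (carlesonMass α J).toReal / J.len

lemma carlesonMass_split (α : Dyadic → ℝ≥0) (J : Dyadic) :
    carlesonMass α J = ENNReal.ofReal (α J * J.len) +
      (carlesonMass α J.left + carlesonMass α J.right) := by
  unfold carlesonMass
  rw [subtreeSum_split, J.volume_interval, ENNReal.ofReal_mul (α J).coe_nonneg, ENNReal.ofReal_coe_nnreal]

lemma massDensity_nonneg (α : Dyadic → ℝ≥0) (J : Dyadic) : 0 ≤ massDensity α J :=
  div_nonneg ENNReal.toReal_nonneg J.len_pos.le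

lemma massDensity_le_one {α : Dyadic → ℝ≥0} {J : Dyadic}
    (h : carlesonMass α J ≤ ENNReal.ofReal J.len) : massDensity α J ≤ 1 :=
  (div_le_one J.len_pos).2 (ENNReal.toReal_le_of_le_ofReal J.len_pos.le h)

lemma massDensity_split {α : Dyadic → ℝ≥0} (h : ∀ J, carlesonMass α J ≤ ENNReal.ofReal J.len)
    (J : Dyadic) :
    massDensity α J = (massDensity α J.left + massDensity α J.right) / 2 + α J := by
  have hfin (K : Dyadic) : carlesonMass α K ≠ ∞ := ne_top_of_le_ne_top ENNReal.ofReal_ne_top (h K)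
  have hl := J.len_pos
  unfold massDensity
  rw [carlesonMass_split, ENNReal.toReal_add ENNReal.ofReal_ne_top
    (ENNReal.add_ne_top.2 ⟨hfin _, hfin _⟩), ENNReal.toReal_add (hfin _) (hfin _),
    ENNReal.toReal_ofReal (mul_nonneg (α J).coe_nonneg hl.le), J.len_left, J.len_right]
  field_simp
  ring

/-- The superlevel set of the local operator inside `J`. -/
def levelSet (α : Dyadic → ℝ≥0) (f : ℝ → ℝ) (J : Dyadic) (lam : ℝ) : Set ℝ :=
  {x | x ∈ J.interval ∧ ENNReal.ofReal lam < localOp α f J x}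

lemma volume_levelSet_le (α : Dyadic → ℝ≥0) (f : ℝ → ℝ) (J : Dyadic) (lam : ℝ) :
    volume (levelSet α f J lam) ≤ ENNReal.ofReal J.len :=
  (measure_mono fun _ hx => hx.1).trans_eq J.volume_interval

lemma levelSet_subset (α : Dyadic → ℝ≥0) (f : ℝ → ℝ) (J : Dyadic) (lam : ℝ)
    (hF : 0 ≤ ⨍ y in J.interval, f y) (hlam : 0 ≤ lam - α J * ⨍ y in J.interval, f y) :
    levelSet α f J lam ⊆
      levelSet α f J.left (lam - α J * ⨍ y in J.interval, f y) ∪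
        levelSet α f J.right (lam - α J * ⨍ y in J.interval, f y) := by
  rintro x ⟨hxJ, hx⟩
  have aux {u : ℝ≥0∞} (hu : ENNReal.ofReal lam <
      (α J : ℝ≥0∞) * ENNReal.ofReal (⨍ y in J.interval, f y) + u) :
      ENNReal.ofReal (lam - α J * ⨍ y in J.interval, f y) < u := by
    contrapose! hu
    rw [← ENNReal.ofReal_coe_nnreal, ← ENNReal.ofReal_mul (α J).coe_nonneg]
    refine (add_le_add_right hu _).trans ?_
    -- Nonnegativity of the lowered level is essential: otherwise `ENNReal.ofReal` would truncate
    -- it.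
    rw [← ENNReal.ofReal_add (mul_nonneg (α J).coe_nonneg hF) hlam, add_sub_cancel]
  rw [← J.interval_union] at hxJ
  rcases hxJ with h | h
  · left
    rw [localOp_of_mem_left α f h] at hx
    exact ⟨h, aux hx⟩
  · right
    rw [localOp_of_mem_right α f h] at hx
    exact ⟨h, aux hx⟩

/-- The Bellman bound for sequences supported on finitely many generations. -/
lemma volume_levelSet_le_bellman {f : ℝ → ℝ} {α : Dyadic → ℝ≥0} {N : ℕ}
    (hf : IntegrableOn f (Ico 0 1)) (hF : ∀ J : Dyadic, 0 ≤ ⨍ y in J.interval, f y)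
    (hα : ∀ J, carlesonMass α J ≤ ENNReal.ofReal J.len) (hN : ∀ K : Dyadic, N ≤ K.1 → α K = 0)
    (m : ℕ) : ∀ J : Dyadic, N ≤ J.1 + m → ∀ lam : ℝ, 0 < lam →
      volume (levelSet α f J lam) ≤
        ENNReal.ofReal (J.len * bellman ((⨍ y in J.interval, f y) / lam) (massDensity α J)) := by
  induction m with
  | zero =>
    intro J hJ lam hlam
    have : levelSet α f J lam = ∅ := by
      refine eq_empty_of_forall_notMem fun x hx => ?_
      have h0 : localOp α f J x = 0 := subtreeSum_eq_zero fun K hK => by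
        rw [lernerTerm, hN K (hJ.trans (Dyadic.level_le_of_subset hK))]
        simp
      have := hx.2
      simp [h0] at this
    simp [this]
  | succ m ih =>
    intro J hJ lam hlam
    have hfJ : IntegrableOn f J.interval :=
      hf.mono_set (Dyadic.root_interval ▸ J.subset_root)
    have hl := J.len_pos
    obtain ⟨F, hFe⟩ : ∃ F, F = ⨍ y in J.interval, f y := ⟨_, rfl⟩
    obtain ⟨F₀, hF₀e⟩ : ∃ F, F = ⨍ y in J.left.interval, f y := ⟨_, rfl⟩
    obtain ⟨F₁, hF₁e⟩ : ∃ F, F = ⨍ y in J.right.interval, f y := ⟨_, rfl⟩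
    have hF0 : 0 ≤ F := hFe ▸ hF J
    have hF₀ : 0 ≤ F₀ := hF₀e ▸ hF J.left
    have hF₁ : 0 ≤ F₁ := hF₁e ▸ hF J.right
    have hsplit : F = (F₀ + F₁) / 2 := by rw [hFe, hF₀e, hF₁e, average_split hfJ]
    have hA₀ := massDensity_nonneg α J.left
    have hA₁ := massDensity_nonneg α J.right
    have hA1 := massDensity_le_one (hα J)
    have hA := massDensity_split hα J
    have ha : (0 : ℝ) ≤ α J := (α J).coe_nonneg
    have hsub := levelSet_subset α f J lam (hF J)
    rw [← hFe] at hsub ⊢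
    -- If the term of `J` alone reaches the level, then `F * massDensity α J ≥ lam`, the Bellman
    -- value is `1`, and the bound is trivial.
    rcases le_or_gt (lam - α J * F) 0 with hle | hgt
    · have h1 : bellman (F / lam) (massDensity α J) = 1 := by
        refine bellman_eq_one (by positivity) hA1 ?_
        rw [div_mul_eq_mul_div, one_le_div hlam]
        nlinarith
      rw [h1, mul_one]
      exact volume_levelSet_le α f J lam
    · have e₀ := ih J.left (by simp only [Dyadic.left]; omega) _ hgt
      have e₁ := ih J.right (by simp only [Dyadic.right]; omega) _ hgt
      rw [← hF₀e, J.len_left] at e₀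
      rw [← hF₁e, J.len_right] at e₁
      refine (measure_mono (hsub hgt.le)).trans ((measure_union_le _ _).trans ((add_le_add e₀ e₁).trans ?_))
      have n₀ := bellman_nonneg (div_nonneg hF₀ hgt.le) hA₀
      have n₁ := bellman_nonneg (div_nonneg hF₁ hgt.le) hA₁
      rw [← ENNReal.ofReal_add (by positivity) (by positivity)]
      refine ENNReal.ofReal_le_ofReal ?_
      have hmid := bellman_midpoint (div_nonneg hF₀ hgt.le) (div_nonneg hF₁ hgt.le) hA₀ hA₁
      have hax : α J * (F / lam) < 1 := by
        rw [← mul_div_assoc, div_lt_one hlam]; linarith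
      have hjump := bellman_jump (div_nonneg hF0 hlam.le) (by positivity) ha (hA ▸ hA1) hax
      rw [← hA] at hjump
      -- Renormalizing by the lowered level turns the average of the halves into the argument of the
      -- jump inequality.
      have harg : F / lam / (1 - α J * (F / lam)) =
          (F₀ / (lam - α J * F) + F₁ / (lam - α J * F)) / 2 := by
        have : 1 - α J * (F / lam) = (lam - α J * F) / lam := by field_simp
        rw [this, div_div_div_cancel_right₀ hlam.ne', ← add_div, div_right_comm, ← hsplit]
      rw [harg] at hjump
      have := mul_le_mul_of_nonneg_left (hmid.trans hjump) hl.le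
      linarith

/-! ### Passage to arbitrary sequences and the weak-type bound -/

/-- The sequence `α` restricted to the first `N` generations. -/
def truncate (α : Dyadic → ℝ≥0) (N : ℕ) (K : Dyadic) : ℝ≥0 := if K.1 < N then α K else 0

lemma truncate_le (α : Dyadic → ℝ≥0) (N : ℕ) (K : Dyadic) : truncate α N K ≤ α K := by
  unfold truncate
  split_ifs <;> simp

lemma truncate_mono (α : Dyadic → ℝ≥0) {M N : ℕ} (h : M ≤ N) (K : Dyadic) :
    truncate α M K ≤ truncate α N K := by
  unfold truncate
  split_ifs
  · exact le_rfl
  · omega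
  · simp
  · simp

lemma lernerTerm_mono {α β : Dyadic → ℝ≥0} (h : ∀ K, α K ≤ β K) (f : ℝ → ℝ) (x : ℝ)
    (K : Dyadic) : lernerTerm α f x K ≤ lernerTerm β f x K := by
  unfold lernerTerm
  refine indicator_le_indicator ?_
  gcongr
  exact h K

/-- A sum in `[0, ∞]` is the supremum of its finite partial sums, and finitely many intervals occupy
finitely many generations. -/
lemma exists_truncate_lt {α : Dyadic → ℝ≥0} {f : ℝ → ℝ} {x : ℝ} {c : ℝ≥0∞}
    (h : c < lernerOp α f x) : ∃ N, c < lernerOp (truncate α N) f x := by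
  have h' : c < ∑' K, lernerTerm α f x K := h
  rw [ENNReal.tsum_eq_iSup_sum, lt_iSup_iff] at h'
  obtain ⟨s, hs⟩ := h'
  refine ⟨s.sup (fun K => K.1) + 1, hs.trans_le ?_⟩
  refine le_trans (le_of_eq ?_) (ENNReal.sum_le_tsum s)
  refine Finset.sum_congr rfl fun K hK => ?_
  have : K.1 < s.sup (fun K => K.1) + 1 :=
    Nat.lt_succ_of_le (Finset.le_sup (f := fun K : Dyadic => K.1) hK)
  simp [lernerTerm, truncate, this]

lemma NonnegL1.setIntegral_nonneg {f : ℝ → ℝ} (hf : NonnegL1 f) (J : Dyadic) :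
    0 ≤ ∫ y in J.interval, f y :=
  integral_nonneg_of_ae
    (ae_mono (Measure.restrict_mono_set _ (Dyadic.root_interval ▸ J.subset_root)) hf.2)

lemma NonnegL1.normL1_eq {f : ℝ → ℝ} (hf : NonnegL1 f) :
    normL1 f = ∫ y in Ico (0 : ℝ) 1, f y :=
  integral_congr_ae (hf.2.mono fun _ hx => abs_of_nonneg hx)

lemma normL1_nonneg (f : ℝ → ℝ) : 0 ≤ normL1 f := integral_nonneg fun _ => abs_nonneg _

theorem distrib_lernerOp_le {f : ℝ → ℝ} {α : Dyadic → ℝ≥0} (hf : NonnegL1 f)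
    (hα : carlesonConst α ≤ 1) {lam : ℝ} (hlam : 0 < lam) :
    distrib (lernerOp α f) lam ≤ ENNReal.ofReal (levelBound (normL1 f) lam) := by
  rw [carlesonConst_le_one_iff] at hα
  have hset (β : Dyadic → ℝ≥0) : {x : ℝ | x ∈ Ico (0 : ℝ) 1 ∧ ENNReal.ofReal lam < lernerOp β f x}
      = levelSet β f Dyadic.root lam := by
    rw [levelSet, Dyadic.root_interval, localOp_root]
  have hunion : levelSet α f Dyadic.root lam ⊆
      ⋃ N, levelSet (truncate α N) f Dyadic.root lam := by
    rintro x ⟨hx, hlt⟩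
    rw [localOp_root] at hlt
    obtain ⟨N, hN⟩ := exists_truncate_lt hlt
    exact mem_iUnion.2 ⟨N, hx, by rwa [localOp_root]⟩
  have hmono : Monotone fun N => levelSet (truncate α N) f Dyadic.root lam :=
    fun M N hMN x hx => ⟨hx.1, hx.2.trans_le
      (subtreeSum_mono (lernerTerm_mono (truncate_mono α hMN) f x) _)⟩
  have hF (J : Dyadic) : 0 ≤ ⨍ y in J.interval, f y := by
    rw [average_eq]
    exact div_nonneg (hf.setIntegral_nonneg J) J.len_pos.le
  rw [distrib, hset]
  refine (measure_mono hunion).trans ?_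
  rw [hmono.measure_iUnion]
  refine iSup_le fun N => ?_
  have hβ (J : Dyadic) : carlesonMass (truncate α N) J ≤ ENNReal.ofReal J.len := by
    refine (subtreeSum_mono (fun K => ?_) J).trans (hα J)
    gcongr
    exact truncate_le α N K
  refine (volume_levelSet_le_bellman (N := N) hf.1 hF hβ
    (fun K hK => by simp [truncate, hK.not_gt]) N Dyadic.root (by omega) lam hlam).trans ?_
  refine ENNReal.ofReal_le_ofReal ?_
  have havg : ⨍ y in Dyadic.root.interval, f y = normL1 f := by
    rw [average_eq, Dyadic.root_len, div_one, Dyadic.root_interval, hf.normL1_eq]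
  rw [Dyadic.root_len, one_mul, havg, ← bellman_one (normL1_nonneg f) hlam]
  exact bellman_mono_right (div_nonneg (normL1_nonneg f) hlam.le) (massDensity_nonneg _ _)
    (massDensity_le_one (hβ _))

theorem weakL1_lernerOp_le {f : ℝ → ℝ} {α : Dyadic → ℝ≥0} (hf : NonnegL1 f)
    (hα : carlesonConst α ≤ 1) :
    weakL1 (lernerOp α f) ≤ 2 * ENNReal.ofReal (normL1 f) := by
  refine iSup₂_le fun lam hlam => ?_
  have ht := normL1_nonneg f
  have h2 : (2 : ℝ≥0∞) = ENNReal.ofReal 2 := by simp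
  rw [h2, ← ENNReal.ofReal_mul zero_le_two]
  refine (mul_le_mul_right (distrib_lernerOp_le hf hα hlam) _).trans ?_
  rw [← ENNReal.ofReal_mul hlam.le]
  refine ENNReal.ofReal_le_ofReal ?_
  unfold levelBound
  split_ifs with h
  · rw [← mul_div_assoc, div_le_iff₀ (by linarith)]
    nlinarith
  · linarith

/-! ### Near-extremizers -/

lemma carlesonMass_congr {α β : Dyadic → ℝ≥0} {J : Dyadic}
    (h : ∀ K : Dyadic, K.interval ⊆ J.interval → α K = β K) :
    carlesonMass α J = carlesonMass β J :=
  subtreeSum_congr fun K hK => by rw [h K hK]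

lemma levelSet_congr {α β : Dyadic → ℝ≥0} {f g : ℝ → ℝ} {J : Dyadic}
    (h : ∀ K : Dyadic, K.interval ⊆ J.interval → α K = β K) (hfg : EqOn f g J.interval) (lam : ℝ) :
    levelSet α f J lam = levelSet β g J lam := by
  have (x : ℝ) : localOp α f J x = localOp β g J x := subtreeSum_congr fun K hK => by
    rw [lernerTerm, lernerTerm, h K hK, average_eq, average_eq,
      setIntegral_congr_fun K.measurableSet_interval (hfg.mono hK)]
  simp only [levelSet, this]

/-- On every dyadic interval there are a nonnegative function with average `x` and a Carleson
sequence of normalized mass at most `A` for which the superlevel set at `lam` fills at least the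
fraction `v` of the interval. -/
def Achievable (x A lam v : ℝ) : Prop :=
  ∀ J : Dyadic, ∃ (f : ℝ → ℝ) (α : Dyadic → ℝ≥0),
    IntegrableOn f J.interval ∧ (∀ y, 0 ≤ f y) ∧ ∫ y in J.interval, f y = x * J.len ∧
    carlesonMass α J ≤ ENNReal.ofReal (A * J.len) ∧
    (∀ K : Dyadic, K.interval ⊆ J.interval → carlesonMass α K ≤ ENNReal.ofReal K.len) ∧
    ENNReal.ofReal (v * J.len) ≤ volume (levelSet α f J lam)

lemma achievable_zero (lam : ℝ) : Achievable 0 0 lam 0 := fun J =>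
  ⟨0, 0, integrableOn_zero, fun _ => le_rfl, by simp,
    by simp [carlesonMass, subtreeSum], fun K _ => by simp [carlesonMass, subtreeSum], by simp⟩

/-- Place the two configurations on the halves of `J` and the coefficient `a` on `J` itself: its
term adds the constant `a * (x₀ + x₁) / 2` throughout `J`, which pays for the higher level. -/
lemma Achievable.glue {x₀ x₁ A₀ A₁ lam v₀ v₁ : ℝ} (h₀ : Achievable x₀ A₀ lam v₀)
    (h₁ : Achievable x₁ A₁ lam v₁) (hA₀ : 0 ≤ A₀) (hA₁ : 0 ≤ A₁)
    {a : ℝ} (ha : 0 ≤ a) (hle : (A₀ + A₁) / 2 + a ≤ 1) :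
    Achievable ((x₀ + x₁) / 2) ((A₀ + A₁) / 2 + a) (lam + a * ((x₀ + x₁) / 2))
      ((v₀ + v₁) / 2) := by
  classical
  intro J
  obtain ⟨f₀, α₀, hf₀, hp₀, hi₀, hm₀, hc₀, hv₀⟩ := h₀ J.left
  obtain ⟨f₁, α₁, hf₁, hp₁, hi₁, hm₁, hc₁, hv₁⟩ := h₁ J.right
  have hl := J.len_pos
  rw [J.len_left] at hi₀ hm₀ hv₀
  rw [J.len_right] at hi₁ hm₁ hv₁
  obtain ⟨f, hf⟩ : ∃ f, f = fun y => if y ∈ J.left.interval then f₀ y else f₁ y := ⟨_, rfl⟩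
  obtain ⟨α, hα⟩ : ∃ α : Dyadic → ℝ≥0, α = fun K =>
    if K = J then a.toNNReal else if K.interval ⊆ J.left.interval then α₀ K else α₁ K := ⟨_, rfl⟩
  have hαJ : (α J : ℝ) = a := by simp [hα, ha]
  have eα₀ (K : Dyadic) (hK : K.interval ⊆ J.left.interval) : α K = α₀ K := by
    have hne : K ≠ J := by rintro rfl; exact K.not_subset_left hK
    simp [hα, hne, hK]
  have eα₁ (K : Dyadic) (hK : K.interval ⊆ J.right.interval) : α K = α₁ K := by
    have hne : K ≠ J := by rintro rfl; exact K.not_subset_right hK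
    have hnl : ¬ K.interval ⊆ J.left.interval :=
      fun hl => Dyadic.not_subset_right_of_left hl hK
    simp [hα, hne, hnl]
  have ef₀ : EqOn f f₀ J.left.interval := fun y hy => by simp [hf, hy]
  have ef₁ : EqOn f f₁ J.right.interval := fun y hy => by
    simp [hf, Set.disjoint_right.1 J.disjoint_interval hy]
  have hint : IntegrableOn f J.interval := by
    rw [← J.interval_union]
    exact (hf₀.congr_fun ef₀.symm J.left.measurableSet_interval).union
      (hf₁.congr_fun ef₁.symm J.right.measurableSet_interval)
  have hintegral : ∫ y in J.interval, f y = (x₀ + x₁) / 2 * J.len := by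
    rw [integral_split hint, setIntegral_congr_fun J.left.measurableSet_interval ef₀,
      setIntegral_congr_fun J.right.measurableSet_interval ef₁, hi₀, hi₁]
    ring
  have havg : ⨍ y in J.interval, f y = (x₀ + x₁) / 2 := by
    rw [average_eq, hintegral, mul_div_cancel_right₀ _ hl.ne']
  have hmass : carlesonMass α J ≤ ENNReal.ofReal (((A₀ + A₁) / 2 + a) * J.len) := by
    rw [carlesonMass_split, carlesonMass_congr eα₀, carlesonMass_congr eα₁, hαJ]
    refine (add_le_add_right (add_le_add hm₀ hm₁) _).trans (le_of_eq ?_)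
    rw [← ENNReal.ofReal_add (by positivity) (by positivity),
      ← ENNReal.ofReal_add (by positivity) (by positivity)]
    congr 1
    ring
  have hlevel {u : ℝ≥0∞} (hu : ENNReal.ofReal lam < u) :
      ENNReal.ofReal (lam + a * ((x₀ + x₁) / 2)) <
        (α J : ℝ≥0∞) * ENNReal.ofReal (⨍ y in J.interval, f y) + u := by
    rw [havg, ← ENNReal.ofReal_coe_nnreal, hαJ, ← ENNReal.ofReal_mul ha, add_comm lam]
    exact ENNReal.ofReal_add_le.trans_lt ((ENNReal.add_lt_add_iff_left ENNReal.ofReal_ne_top).2 hu)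
  refine ⟨f, α, hint, fun y => ?_, hintegral, hmass, fun K hK => ?_, ?_⟩
  · rw [hf]
    dsimp only
    split_ifs
    exacts [hp₀ y, hp₁ y]
  · rcases Dyadic.subset_cases hK with rfl | h | h
    · refine hmass.trans (ENNReal.ofReal_le_ofReal ?_)
      nlinarith
    · rw [carlesonMass_congr fun L hL => eα₀ L (hL.trans h)]
      exact hc₀ K h
    · rw [carlesonMass_congr fun L hL => eα₁ L (hL.trans h)]
      exact hc₁ K h
  · rw [← levelSet_congr eα₀ ef₀] at hv₀
    rw [← levelSet_congr eα₁ ef₁] at hv₁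
    -- Cutting along the left half requires measurability of that interval only, not of the level
    -- set.
    rw [← measure_inter_add_sdiff _ J.left.measurableSet_interval]
    have hsplit : (v₀ + v₁) / 2 * J.len = v₀ * (J.len / 2) + v₁ * (J.len / 2) := by ring
    rw [hsplit]
    refine ENNReal.ofReal_add_le.trans
      (add_le_add (hv₀.trans (measure_mono ?_)) (hv₁.trans (measure_mono ?_)))
    · rintro x ⟨hx, hlt⟩
      refine ⟨⟨J.left_subset hx, ?_⟩, hx⟩
      rw [localOp_of_mem_left α f hx]
      exact hlevel hlt
    · rintro x ⟨hx, hlt⟩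
      refine ⟨⟨J.right_subset hx, ?_⟩, Set.disjoint_right.1 J.disjoint_interval hx⟩
      rw [localOp_of_mem_right α f hx]
      exact hlevel hlt

/-- A constant function above the level, with the whole mass on the interval itself. -/
lemma achievable_one {y lam : ℝ} (hy : 0 < y) (h : lam < y) : Achievable y 1 lam 1 := by
  classical
  intro J
  have hl := J.len_pos
  obtain ⟨α, hα⟩ : ∃ α : Dyadic → ℝ≥0, α = fun K => if K = J then 1 else 0 := ⟨_, rfl⟩
  have hmass₀ (K : Dyadic) (hK : ¬ J.interval ⊆ K.interval) : carlesonMass α K = 0 := by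
    refine subtreeSum_eq_zero fun L hL => ?_
    have : L ≠ J := by rintro rfl; exact hK hL
    simp [hα, this]
  have hmass : carlesonMass α J = ENNReal.ofReal J.len := by
    rw [carlesonMass_split, hmass₀ _ J.not_subset_left, hmass₀ _ J.not_subset_right]
    simp [hα]
  have hintegral : ∫ _ in J.interval, y = y * J.len := by
    rw [setIntegral_const, J.volume_real_interval, smul_eq_mul, mul_comm]
  refine ⟨fun _ => y, α, ?_, fun _ => hy.le, hintegral, ?_, fun K hK => ?_, ?_⟩
  · exact integrableOn_const (by simp [J.volume_interval]) (by simp)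
  · rw [hmass, one_mul]
  · rcases Dyadic.subset_cases hK with rfl | h | h
    · exact hmass.le
    · rw [hmass₀ K fun h' => J.not_subset_left (h'.trans h)]; exact zero_le
    · rw [hmass₀ K fun h' => J.not_subset_right (h'.trans h)]; exact zero_le
  · rw [one_mul, ← J.volume_interval]
    refine measure_mono fun x hx => ⟨hx, ?_⟩
    have h1 : lernerTerm α (fun _ => y) x J ≤ localOp α (fun _ => y) J x := by
      rw [localOp, subtreeSum_split]
      exact le_self_add
    refine lt_of_lt_of_le ?_ h1
    rw [lernerTerm, indicator_of_mem hx, average_eq, hintegral, mul_div_cancel_right₀ _ hl.ne']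
    simpa [hα, ENNReal.ofReal_lt_ofReal_iff hy] using h

/-- Copies of the configuration fill all but the fraction `(1 / 2) ^ m` of the interval, where
everything is zero. -/
lemma Achievable.dilute {x lam v : ℝ} (h : Achievable x 1 lam v) (m : ℕ) :
    Achievable ((1 - (1 / 2) ^ m) * x) (1 - (1 / 2) ^ m) lam ((1 - (1 / 2) ^ m) * v) := by
  induction m with
  | zero => simpa using achievable_zero lam
  | succ m ih =>
    have hp : ((1 : ℝ) / 2) ^ m ≤ 1 := pow_le_one₀ (by norm_num) (by norm_num)
    have hp0 : (0 : ℝ) < (1 / 2) ^ m := by positivity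
    have := h.glue ih zero_le_one (by linarith)
      (le_refl (0 : ℝ)) (by linarith)
    convert this using 1 <;> ring

/-- One step of the extremal process. -/
lemma Achievable.step {x lam v : ℝ} (h : Achievable x 1 lam v) (m : ℕ) {r : ℝ}
    (hr : r = 1 - (1 / 2) ^ (m + 1)) :
    Achievable (r * x) 1 (lam + (1 - r) * (r * x)) (r * v) := by
  have hp : ((1 : ℝ) / 2) ^ m ≤ 1 := pow_le_one₀ (by norm_num) (by norm_num)
  have hp0 : (0 : ℝ) < (1 / 2) ^ m := by positivity
  rw [pow_succ] at hr
  -- The halves have masses `1` and `1 - (1 / 2) ^ m`, with mean `r`; the coefficient `1 - r`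
  -- restores total mass `1`.
  have := h.glue (h.dilute m) zero_le_one (by linarith)
    (by linarith : 0 ≤ 1 - r) (by linarith)
  subst hr
  convert this using 1 <;> ring

/-- The level increments `(1 - r) * r ^ j * y`, for `j` from `1` to `k`, sum to `r * (1 - r ^ k) *
y`. -/
lemma achievable_iterate {y lam : ℝ} (hy : 0 < y) (h : lam < y) (m : ℕ) {r : ℝ}
    (hr : r = 1 - (1 / 2) ^ (m + 1)) (k : ℕ) :
    Achievable (r ^ k * y) 1 (lam + r * (1 - r ^ k) * y) (r ^ k) := by
  have hr0 : 0 ≤ r := by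
    have : ((1 : ℝ) / 2) ^ (m + 1) ≤ 1 := pow_le_one₀ (by norm_num) (by norm_num)
    linarith
  induction k with
  | zero => simpa using achievable_one hy h
  | succ k ih =>
    have := ih.step m hr
    convert this using 1 <;> ring

lemma achievable_near {t lam : ℝ} (ht : 0 < t) (htl : t ≤ lam) (m : ℕ) {r : ℝ}
    (hr : r = 1 - (1 / 2) ^ (m + 1)) :
    ∃ v, r * ((1 + r) * t / (lam + r * t)) ≤ v ∧ Achievable t 1 lam v := by
  have hp : ((1 : ℝ) / 2) ^ (m + 1) < 1 := pow_lt_one₀ (by norm_num) (by norm_num) (by omega)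
  have hp0 : (0 : ℝ) < (1 / 2) ^ (m + 1) := by positivity
  have hr0 : 0 < r := by linarith
  have hr1 : r < 1 := by linarith
  have hd : 0 < lam + r * t := by have := mul_pos hr0 ht; linarith
  -- With `v = r ^ k` and `y = t / v`, the starting level lies below `y` exactly when `v` is below
  -- this threshold. The largest such power of `r` loses at most a factor `r`.
  obtain ⟨n, hn, hn'⟩ := exists_nat_pow_near_of_lt_one
    (x := (1 + r) * t / (lam + r * t)) (by positivity)
    ((div_le_one hd).2 (by nlinarith)) hr0 hr1
  have hk : 0 < r ^ (n + 1) := by positivity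
  rw [lt_div_iff₀ hd] at hn
  refine ⟨r ^ (n + 1), ?_, ?_⟩
  · rw [pow_succ, mul_comm r]
    exact mul_le_mul_of_nonneg_right hn' hr0.le
  · have hlt : lam - r * (1 - r ^ (n + 1)) * (t / r ^ (n + 1)) < t / r ^ (n + 1) := by
      rw [sub_lt_iff_lt_add, ← mul_div_assoc, ← add_div, lt_div_iff₀ hk]
      linarith
    have := achievable_iterate (div_pos ht hk) hlt m hr (n + 1)
    rwa [mul_div_cancel₀ _ hk.ne', sub_add_cancel] at this

lemma Achievable.exists_lernerOp {t lam v : ℝ} (h : Achievable t 1 lam v) :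
    ∃ (f : ℝ → ℝ) (α : Dyadic → ℝ≥0), NonnegL1 f ∧ normL1 f = t ∧ carlesonConst α ≤ 1 ∧
      ENNReal.ofReal v ≤ distrib (lernerOp α f) lam := by
  obtain ⟨f, α, hf, hp, hi, -, hc, hv⟩ := h Dyadic.root
  rw [Dyadic.root_interval] at hf hi
  rw [Dyadic.root_len, mul_one] at hi hv
  have hf' : NonnegL1 f := ⟨hf, Filter.Eventually.of_forall hp⟩
  refine ⟨f, α, hf', hf'.normL1_eq.trans hi,
    (carlesonConst_le_one_iff α).2 fun J => hc J J.subset_root, ?_⟩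
  rwa [levelSet, Dyadic.root_interval, localOp_root] at hv

theorem isLUB_distrib_lernerOp {t lam : ℝ} (ht : 0 ≤ t) (hlam : 0 < lam) :
    IsLUB {m : ℝ≥0∞ | ∃ (f : ℝ → ℝ) (α : Dyadic → ℝ≥0), NonnegL1 f ∧ normL1 f = t ∧
      carlesonConst α ≤ 1 ∧ m = distrib (lernerOp α f) lam}
      (ENNReal.ofReal (levelBound t lam)) := by
  refine ⟨?_, fun c hc => ?_⟩
  · rintro m ⟨f, α, hf, rfl, hα, rfl⟩
    exact distrib_lernerOp_le hf hα hlam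
  have key {v : ℝ} (h : Achievable t 1 lam v) : ENNReal.ofReal v ≤ c := by
    obtain ⟨f, α, hf, hn, hα, hv⟩ := h.exists_lernerOp
    exact hv.trans (hc ⟨f, α, hf, hn, hα, rfl⟩)
  unfold levelBound
  split_ifs with htl
  · rcases ht.eq_or_lt with rfl | ht
    · simp
    have hbound (m : ℕ) : ENNReal.ofReal ((1 - (1 / 2) ^ (m + 1)) *
        ((1 + (1 - (1 / 2) ^ (m + 1))) * t / (lam + (1 - (1 / 2) ^ (m + 1)) * t))) ≤ c := by
      obtain ⟨v, hv, hA⟩ := achievable_near ht htl m rfl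
      exact (ENNReal.ofReal_le_ofReal hv).trans (key hA)
    refine le_of_tendsto' (x := Filter.atTop) ?_ hbound
    refine ENNReal.tendsto_ofReal ?_
    have hr : Filter.Tendsto (fun m : ℕ => (1 : ℝ) - (1 / 2) ^ (m + 1)) Filter.atTop
        (nhds 1) := by
      have := (tendsto_pow_atTop_nhds_zero_of_lt_one (r := (1 : ℝ) / 2) (by norm_num)
        (by norm_num)).comp (Filter.tendsto_add_atTop_nat 1)
      simpa using this.const_sub 1
    -- As `r` tends to `1`, the achievable fractions reach the bound.
    have hcont : ContinuousAt (fun r : ℝ => r * ((1 + r) * t / (lam + r * t))) 1 := by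
      refine continuousAt_id.mul (ContinuousAt.div (by fun_prop) (by fun_prop) ?_)
      linarith
    have he : 2 * t / (lam + t) = 1 * ((1 + 1) * t / (lam + 1 * t)) := by norm_num
    rw [he]
    exact hcont.tendsto.comp hr
  · exact key (achievable_one (by linarith) (by linarith))

theorem two_le_of_weakL1_le {C : ℝ≥0∞}
    (hC : ∀ (f : ℝ → ℝ) (α : Dyadic → ℝ≥0), NonnegL1 f → carlesonConst α ≤ 1 →
      weakL1 (lernerOp α f) ≤ C * ENNReal.ofReal (normL1 f)) : 2 ≤ C := by
  have hbound (n : ℕ) : ENNReal.ofReal (2 / (1 + 1 / ((n : ℝ) + 1))) ≤ C := by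
    obtain ⟨t, hte⟩ : ∃ t : ℝ, t = 1 / ((n : ℝ) + 1) := ⟨_, rfl⟩
    have ht : 0 < t := by rw [hte]; positivity
    have ht1 : t ≤ 1 := by
      rw [hte, div_le_one (by positivity)]
      have : (0 : ℝ) ≤ n := n.cast_nonneg
      linarith
    have hle : ENNReal.ofReal (levelBound t 1) ≤ C * ENNReal.ofReal t := by
      refine (isLUB_distrib_lernerOp ht.le one_pos).2 ?_
      rintro m ⟨f, α, hf, rfl, hα, rfl⟩
      refine le_trans ?_ (hC f α hf hα)
      have := le_iSup₂ (f := fun (lam : ℝ) (_ : 0 < lam) =>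
        ENNReal.ofReal lam * distrib (lernerOp α f) lam) 1 one_pos
      simpa [weakL1] using this
    rw [← hte]
    -- At level `1` the quotient of bound and norm is `2 / (1 + t)`, which tends to `2` as `t` tends
    -- to `0`.
    have he : levelBound t 1 = 2 / (1 + t) * t := by
      rw [levelBound, if_pos ht1]; ring
    rw [he, ENNReal.ofReal_mul (by positivity)] at hle
    exact (ENNReal.mul_le_mul_iff_left (by simpa using ht) ENNReal.ofReal_ne_top).1 hle
  have h2 : (2 : ℝ≥0∞) = ENNReal.ofReal (2 / (1 + 0)) := by simp
  rw [h2]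
  refine le_of_tendsto' (x := Filter.atTop) ?_ hbound
  refine ENNReal.tendsto_ofReal ?_
  exact tendsto_const_nhds.div (tendsto_const_nhds.add tendsto_one_div_add_atTop_nhds_zero_nat)
    (by norm_num)

end DyadicShift

end

theorem mainTheorem2 :
    -- the bound on the superlevel sets
    (∀ (f : ℝ → ℝ) (α : DyadicShift.Dyadic → ℝ≥0),
      DyadicShift.NonnegL1 f → DyadicShift.carlesonConst α ≤ 1 →
      ∀ lam : ℝ, 0 < lam →
        DyadicShift.distrib (DyadicShift.lernerOp α f) lam ≤
          ENNReal.ofReal (DyadicShift.levelBound (DyadicShift.normL1 f) lam)) ∧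
    -- it is sharp for every value of the norm and every level
    (∀ t lam : ℝ, 0 ≤ t → 0 < lam →
      IsLUB
        {m : ℝ≥0∞ | ∃ (f : ℝ → ℝ) (α : DyadicShift.Dyadic → ℝ≥0),
          DyadicShift.NonnegL1 f ∧ DyadicShift.normL1 f = t ∧
          DyadicShift.carlesonConst α ≤ 1 ∧
          m = DyadicShift.distrib (DyadicShift.lernerOp α f) lam}
        (ENNReal.ofReal (DyadicShift.levelBound t lam))) ∧
    -- the weak-type estimate
    (∀ (f : ℝ → ℝ) (α : DyadicShift.Dyadic → ℝ≥0),
      DyadicShift.NonnegL1 f → DyadicShift.carlesonConst α ≤ 1 →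
      DyadicShift.weakL1 (DyadicShift.lernerOp α f) ≤
        2 * ENNReal.ofReal (DyadicShift.normL1 f)) ∧
    -- the constant 2 cannot be lowered
    (∀ C : ℝ≥0∞,
      (∀ (f : ℝ → ℝ) (α : DyadicShift.Dyadic → ℝ≥0),
        DyadicShift.NonnegL1 f → DyadicShift.carlesonConst α ≤ 1 →
        DyadicShift.weakL1 (DyadicShift.lernerOp α f) ≤
          C * ENNReal.ofReal (DyadicShift.normL1 f)) →
      2 ≤ C) := by
  exact ⟨fun _ _ hf hα _ hlam => DyadicShift.distrib_lernerOp_le hf hα hlam,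
    fun _ _ ht hlam => DyadicShift.isLUB_distrib_lernerOp ht hlam,
    fun _ _ hf hα => DyadicShift.weakL1_lernerOp_le hf hα,
    fun _ hC => DyadicShift.two_le_of_weakL1_le hC⟩
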